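/- **Setting.** Let $\Omega\subset\mathbb R^2$ be a nonempty, open, bounded, convex polygonal domain. Let $\mathcal T_h$ be a finite partition of $\overline\Omega$ into strictly convex quadrilaterals without common interior points. No node lies in the relative interior of an edge, and the corners of $\Omega$ are nodes. Let $\Omega_h$ be the set of nodes, $\mathcal N$ its cardinality, and $h$ the largest diameter of the quadrilaterals. For $K\in\mathcal T_h$ let $P_1,P_2,P_3,P_4$ be its vertices in counterclockwise order (indices mod 4). Let $Q=\frac14\sum_i P_i$, and let $\mathcal J_Q$ be the Jacobian determinant at $(\frac12,\frac12)$ of the bilinear map of $[0,1]^2$ onto $K$. Let $\mathbf q_i$ be the vector normal to the diagonal $\sigma=P_{i+1}P_{i+3}$, as long as this diagonal and pointing to the side of $P_i$. The control volume $K_P^*$ of a node $P$ is the union of the triangles $P_{i-1}P_iP_{i+1}$ over all $K$ and $i$ with $P_i=P$. Let $S_{K_P^*}$ be its area and $L=\mathrm{diag}(S_{K_P^*})_{P\in\Omega_h}$. Let $\kappa(x)\in\mathbb R^{2\times2}$ be symmetric positive definite for every $x\in\Omega$ (the diffusion tensor at time $t^{n+1}$). For every boundary edge $\sigma$ of the mesh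 let $\delta_\sigma\ge0$ and $\gamma_\sigma>0$ be given. Let $C>0$, $M>0$ and $\Delta t>0$. For $U=(u_P)_{P\in\Omega_h}\ge0$, $K\in\mathcal T_h$ and $i\in\{1,2,3,4\}$, with $u_j=u_{P_j}$, put $$A_\sigma=\frac{\mathbf q_i\cdot\kappa(Q)^T\mathbf q_i}{2\mathcal J_Q},\qquad r_\sigma=\frac{\mathbf q_{i+1}\cdot\kappa(Q)^T\mathbf q_i}{2\mathcal J_Q}(u_{i+1}-u_{i+3}),\qquad r_\sigma^\pm=\frac{|r_\sigma|\pm r_\sigma}2,$$ $$F_{P_i,\sigma}=\Big(A_\sigma+\frac{r_\sigma^+M}{Mu_i+Ch^2}\Big)u_i-\Big(A_\sigma+\frac{r_\sigma^-M}{Mu_{i+2}+Ch^2}\Big)u_{i+2}.$$ Let $A(U)\in\mathbb R^{\mathcal N\times\mathcal N}$ be the matrix whose row $P$ collects two kinds of coefficients: the above coefficients of the nodal values in all fluxes $F_{P,\sigma}$ ($\sigma$ the diagonal not containing $P$ of a quadrilateral with vertex $P$), and, on the diagonal, $\frac{\delta_\sigma}{\gamma_\sigma}|\sigma|$ for every boundary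 edge $\sigma$ of the mesh with end $P$. **Theorem 3.1.** Let $f^{n+1},g^{n+1},U^n\in\mathbb R^{\mathcal N}$ with $f^{n+1}+g^{n+1}\ge0$ and $U^n\ge0$ componentwise. Then, for any fixed constant $M>0$, the backward-Euler nonlinear finite volume element system $$(L+\Delta t\,A(U^{n+1}))\,U^{n+1}=\Delta t\,(f^{n+1}+g^{n+1})+L\,U^n$$ has a solution $U^{n+1}\in\mathbb R^{\mathcal N}$ with $U^{n+1}\ge0$. -/

import Mathlib

open scoped Matrix

noncomputable section

namespace MonotoneFVE

/-- The Euclidean plane. -/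
abbrev Plane : Type := EuclideanSpace ℝ (Fin 2)

/-- Rotation of a plane vector by a right angle, counterclockwise. -/
def rot (v : Plane) : Plane := !₂[-(v 1), v 0]

/-- The planar cross product. -/
def cross (v w : Plane) : ℝ := v 0 * w 1 - v 1 * w 0

/-- An open, bounded, nonempty, convex (hence connected) polygonal domain. -/
structure IsConvexPolygonalDomain (Ω : Set Plane) : Prop where
  isOpen : IsOpen Ω
  nonempty : Ω.Nonempty
  isBounded : Bornology.IsBounded Ω
  convex : Convex ℝ Ω
  polygonal : ∃ s : Set Plane, s.Finite ∧ closure Ω = convexHull ℝ s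

/-- A conforming partition of `closure Ω` into strictly convex quadrilaterals.  `Node` is the set
of nodes, `Cell` the set of quadrilaterals.  The vertices of the cell `K` are
`vert K 0, vert K 1, vert K 2, vert K 3`, listed counterclockwise; indices in `Fin 4` are cyclic. -/
structure QuadMesh (Ω : Set Plane) (Node Cell : Type*) where
  /-- the position of a node -/
  pos : Node → Plane
  /-- the vertices of a cell -/
  vert : Cell → Fin 4 → Node
  /-- different nodes are different points -/
  pos_injective : Function.Injective pos
  /-- every node is a vertex of some quadrilateral -/
  node_mem : ∀ P, ∃ K i, vert K i = P
  /-- going round a cell one turns strictly to the left at each of the four vertices -/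
  strictly_convex : ∀ K i, 0 < cross (pos (vert K (i + 1)) - pos (vert K i))
    (pos (vert K (i + 2)) - pos (vert K (i + 1)))
  /-- the quadrilaterals fill `closure Ω` -/
  cover : ⋃ K, convexHull ℝ (Set.range fun i => pos (vert K i)) = closure Ω
  /-- different quadrilaterals have no common interior point -/
  disjoint_interior : ∀ K K', K ≠ K' →
    Disjoint (interior (convexHull ℝ (Set.range fun i => pos (vert K i))))
      (interior (convexHull ℝ (Set.range fun i => pos (vert K' i))))
  /-- no node lies in the relative interior of an edge -/
  conforming : ∀ P K i, pos P ∉ openSegment ℝ (pos (vert K i)) (pos (vert K (i + 1)))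
  /-- the corners of the polygon are nodes -/
  corner : Set.extremePoints ℝ (closure Ω) ⊆ Set.range pos

namespace QuadMesh

variable {Ω : Set Plane} {Node Cell : Type*} (T : QuadMesh Ω Node Cell)

/-- The `i`-th vertex of the cell `K`, as a point. -/
def pt (K : Cell) (i : Fin 4) : Plane := T.pos (T.vert K i)

/-- The closed quadrilateral `K`. -/
def cell (K : Cell) : Set Plane := convexHull ℝ (Set.range (T.pt K))

/-- The mesh size: the largest diameter of the quadrilaterals. -/
def meshSize : ℝ := ⨆ K, Metric.diam (T.cell K)

/-- The Jacobi matrix at `(ξ, η)` of the bilinear map of the unit square onto `K` which sends the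
corners `(0,0), (1,0), (1,1), (0,1)` to the vertices `0, 1, 2, 3`. -/
def jacobi (K : Cell) (ξ η : ℝ) : Matrix (Fin 2) (Fin 2) ℝ :=
  let a₁ := T.pt K 1 - T.pt K 0
  let a₂ := T.pt K 3 - T.pt K 0
  let a₃ := T.pt K 0 - T.pt K 1 + T.pt K 2 - T.pt K 3
  !![a₁ 0 + a₃ 0 * η, a₂ 0 + a₃ 0 * ξ;
     a₁ 1 + a₃ 1 * η, a₂ 1 + a₃ 1 * ξ]

/-- The barycenter `Q` of the vertices of `K`, the image of `(1/2, 1/2)` under the bilinear map. -/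
def barycenter (K : Cell) : Plane := (1 / 4 : ℝ) • ∑ i, T.pt K i

/-- The Jacobian determinant at the barycenter. -/
def jacQ (K : Cell) : ℝ := (T.jacobi K (1 / 2) (1 / 2)).det

/-- The vector normal to the diagonal of `K` that does not contain the vertex `i`, of the same
length as this diagonal and pointing to the side of the vertex `i`. -/
def q (K : Cell) (i : Fin 4) : Plane := rot (T.pt K (i + 3) - T.pt K (i + 1))

/-- The part in `K` of the control volume of the vertex `i` of `K`: the triangle cut off from `K`
by the diagonal that does not contain the vertex `i`. -/
def corner_triangle (K : Cell) (i : Fin 4) : Set Plane :=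
  convexHull ℝ {T.pt K (i + 3), T.pt K i, T.pt K (i + 1)}

/-- The control volume (dual element) of the node `P`. -/
def dualCell (P : Node) : Set Plane :=
  ⋃ (K : Cell) (i : Fin 4) (_ : T.vert K i = P), T.corner_triangle K i

/-- The area of the control volume of `P`. -/
def dualArea (P : Node) : ℝ := (MeasureTheory.volume (T.dualCell P)).toReal

/-- The edge from the vertex `i` to the vertex `i + 1` of `K` lies on the boundary of `Ω`. -/
def IsBoundaryEdge (K : Cell) (i : Fin 4) : Prop :=
  segment ℝ (T.pt K i) (T.pt K (i + 1)) ⊆ frontier Ω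

/-- The length of the edge from the vertex `i` to the vertex `i + 1` of `K`. -/
def edgeLength (K : Cell) (i : Fin 4) : ℝ := dist (T.pt K i) (T.pt K (i + 1))

/-- The main coefficient `A_σ` of the flux of the vertex `i` of `K` through the diagonal `σ` that
does not contain this vertex; `κ` is the diffusion tensor. -/
def fluxMain (κ : Plane → Matrix (Fin 2) (Fin 2) ℝ) (K : Cell) (i : Fin 4) : ℝ :=
  ((T.q K i).ofLp ⬝ᵥ ((κ (T.barycenter K))ᵀ *ᵥ (T.q K i).ofLp)) / (2 * T.jacQ K)

/-- The residual `r_σ` of the one-sided flux of the vertex `i` of `K` through the diagonal `σ`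
that does not contain this vertex; it depends on the nodal values `U` at the ends of `σ`.  For the
vertex `i + 2` opposite to `i` it changes its sign. -/
def fluxResidual (κ : Plane → Matrix (Fin 2) (Fin 2) ℝ) (U : Node → ℝ) (K : Cell) (i : Fin 4) : ℝ :=
  ((T.q K (i + 1)).ofLp ⬝ᵥ ((κ (T.barycenter K))ᵀ *ᵥ (T.q K i).ofLp)) / (2 * T.jacQ K) *
    (U (T.vert K (i + 1)) - U (T.vert K (i + 3)))

/-- The coefficient of `u_i` in the two-point flux `F_i = outCoeff * u_i - inCoeff * u_{i+2}`
of the vertex `i` of `K` through the diagonal that does not contain this vertex. -/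
def outCoeff (κ : Plane → Matrix (Fin 2) (Fin 2) ℝ) (M C : ℝ) (U : Node → ℝ)
    (K : Cell) (i : Fin 4) : ℝ :=
  T.fluxMain κ K i + (|T.fluxResidual κ U K i| + T.fluxResidual κ U K i) / 2 * M /
    (M * U (T.vert K i) + C * T.meshSize ^ 2)

/-- The coefficient of `u_{i+2}`, up to the sign, in the two-point flux
`F_i = outCoeff * u_i - inCoeff * u_{i+2}`. -/
def inCoeff (κ : Plane → Matrix (Fin 2) (Fin 2) ℝ) (M C : ℝ) (U : Node → ℝ)
    (K : Cell) (i : Fin 4) : ℝ :=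
  T.fluxMain κ K i + (|T.fluxResidual κ U K i| - T.fluxResidual κ U K i) / 2 * M /
    (M * U (T.vert K (i + 2)) + C * T.meshSize ^ 2)

open Classical in
/-- The contribution `∑ (δ_σ / γ_σ) |σ|` to the coefficient of `u_P` of the boundary edges `σ`
of the control volume of `P`, that is, of the boundary edges of the mesh with the end `P`.
`δ K i` and `γ K i` are the values on the edge from the vertex `i` to the vertex `i + 1` of `K`. -/
def boundaryCoeff [Fintype Cell] (δ γ : Cell → Fin 4 → ℝ) (P : Node) : ℝ :=
  ∑ K, ∑ i, if T.IsBoundaryEdge K i ∧ (T.vert K i = P ∨ T.vert K (i + 1) = P) then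
    δ K i / γ K i * T.edgeLength K i else 0

/-- The matrix `A(U)` of the scheme: the row of `P` collects the coefficients of all two-point
fluxes through the diagonals on the boundary of the control volume of `P`, and of the boundary
fluxes (without their part that does not contain the unknowns). -/
def schemeMatrix [Fintype Cell] [DecidableEq Node] (κ : Plane → Matrix (Fin 2) (Fin 2) ℝ)
    (δ γ : Cell → Fin 4 → ℝ) (M C : ℝ) (U : Node → ℝ) : Matrix Node Node ℝ :=
  (∑ K, ∑ i, (Matrix.single (T.vert K i) (T.vert K i) (T.outCoeff κ M C U K i) -
      Matrix.single (T.vert K i) (T.vert K (i + 2)) (T.inCoeff κ M C U K i))) +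
    Matrix.diagonal (T.boundaryCoeff δ γ)

/-- The diagonal matrix `L` of the areas of the control volumes. -/
def areaMatrix [DecidableEq Node] : Matrix Node Node ℝ := Matrix.diagonal T.dualArea

end QuadMesh

end MonotoneFVE

end

/-! Freeze the coefficients at some $U\ge0$ and put $B(U)=L+\Delta t\,A(U)$. Positive definiteness
of $\kappa(Q)$ and $\mathcal J_Q>0$ give $A_\sigma\ge0$, so the off-diagonal entries of $B(U)$ are
nonpositive. Fluxes of opposite vertices cancel (`inCoeff_add_two`), so the column sum at $P$ is
$S_{K_P^*}$ plus a nonnegative boundary term. Hence $B(U)$ is a nonsingular M-matrix with a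
nonnegative inverse. Summing all equations bounds the solution of the frozen system independently of
$U$. Thus $U\mapsto B(U^+)^{-1}b$ is continuous with values in a fixed box of nonnegative vectors.
Brouwer gives a fixed point; it is nonnegative, so the truncation is inactive and it solves the
system (`exists_nonneg_mulVec_eq`).

Brouwer's theorem rests on a volume argument. If $h$ vanishes on the sphere, $x\mapsto x+th(x)$ maps
the ball bijectively to itself for small $t>0$, so $\int\det(1+th')$ is the volume of the ball. This
is polynomial in $t$, so it also holds at $t=1$; but for a retraction $x+h(x)$ onto the sphere that
determinant vanishes. -/

namespace MonotoneFVE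

/-! ### Brouwer's fixed point theorem -/

section Brouwer

open MeasureTheory Metric Set Filter Topology

/-- The determinant of `1 + t • A` is a polynomial in `t` of degree at most the dimension. -/
theorem exists_polynomial_eval_eq_det_one_add_smul {E : Type*} [NormedAddCommGroup E]
    [NormedSpace ℝ E] [FiniteDimensional ℝ E] (A : E →L[ℝ] E) :
    ∃ p : Polynomial ℝ, p.natDegree ≤ Module.finrank ℝ E ∧
      ∀ t : ℝ, p.eval t = (1 + t • A).det := by
  classical
  let b := Module.finBasis ℝ E
  let B := LinearMap.toMatrix b b A.toLinearMap
  refine ⟨((Polynomial.X : Polynomial ℝ) • B.map Polynomial.C +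
    (1 : Matrix _ _ ℝ).map Polynomial.C).det, ?_, fun t => ?_⟩
  · simpa using Polynomial.natDegree_det_X_add_C_le B 1
  · rw [← Polynomial.coe_evalRingHom, RingHom.map_det, ContinuousLinearMap.det,
      ← LinearMap.det_toMatrix b]
    congr 1
    ext i j
    simp [B, Matrix.one_apply, LinearMap.toMatrix_apply, Finsupp.single_apply, eq_comm]
    rw [add_comm]
    congr 1
    · exact mul_comm _ _
    · split_ifs <;> simp

/-- The value at `1` of a polynomial of degree at most `n` is a combination, with weights of sum one,
of its values at `n + 1` nodes that are as close to `0` as we like. -/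
theorem exists_interpolation_weights (n : ℕ) {ε : ℝ} (hε : 0 < ε) :
    ∃ v w : ℕ → ℝ, (∀ j, 0 < v j ∧ v j < ε) ∧ ∑ j ∈ Finset.range (n + 1), w j = 1 ∧
      ∀ p : Polynomial ℝ, p.natDegree ≤ n →
        p.eval 1 = ∑ j ∈ Finset.range (n + 1), w j * p.eval (v j) := by
  classical
  -- The shift by 2 keeps the node with `j = 0` strictly below `ε`.
  let v : ℕ → ℝ := fun j => ε / (j + 2)
  have hinj : Set.InjOn v (Finset.range (n + 1)) := by
    intro a _ b _ h
    simp only [v] at h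
    have ha : (a : ℝ) + 2 ≠ 0 := by positivity
    have hb : (b : ℝ) + 2 ≠ 0 := by positivity
    rw [div_eq_div_iff ha hb] at h
    have := mul_left_cancel₀ hε.ne' h
    exact_mod_cast (add_right_cancel this).symm
  refine ⟨v, fun j => (Lagrange.basis (Finset.range (n + 1)) v j).eval 1, fun j => ⟨?_, ?_⟩, ?_,
    fun p hp => ?_⟩
  · positivity
  · exact div_lt_self hε (by have : (0 : ℝ) ≤ j := j.cast_nonneg; linarith)
  · rw [← Polynomial.eval_finsetSum, Lagrange.sum_basis hinj (by simp), Polynomial.eval_one]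
  · conv_lhs => rw [Lagrange.eq_interpolate (f := p) hinj (by
      rw [Finset.card_range]
      exact lt_of_le_of_lt Polynomial.degree_le_natDegree (by exact_mod_cast Nat.lt_succ_of_le hp))]
    rw [Lagrange.interpolate_apply, Polynomial.eval_finsetSum]
    simp [mul_comm]

/-- A map that is Lipschitz on the closed unit ball and vanishes on the unit sphere is Lipschitz
after extension by zero. -/
theorem lipschitzWith_indicator_closedBall {E : Type*} [NormedAddCommGroup E] [NormedSpace ℝ E]
    {h : E → E} {c : NNReal} (hl : LipschitzOnWith c h (closedBall 0 1))
    (h0 : ∀ x, ‖x‖ = 1 → h x = 0) :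
    LipschitzWith (2 * c) ((closedBall (0 : E) 1).indicator h) := by
  -- Compare with the radial projection of `y` to the sphere: `h` vanishes there, and its distance
  -- from `x` is at most `2 * ‖x - y‖`.
  have key : ∀ x y : E, ‖x‖ ≤ 1 → 1 < ‖y‖ → ‖h x‖ ≤ 2 * c * ‖x - y‖ := by
    intro x y hx hy
    have hy0 : ‖y‖ ≠ 0 := by positivity
    have hz : ‖‖y‖⁻¹ • y‖ = 1 := by
      rw [norm_smul, norm_inv, norm_norm, inv_mul_cancel₀ hy0]
    have h1 := hl.norm_sub_le (x := x) (y := ‖y‖⁻¹ • y) (by simpa using hx) (by simp [hz])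
    rw [h0 _ hz, sub_zero] at h1
    have h2 : ‖y - ‖y‖⁻¹ • y‖ = ‖y‖ - 1 := by
      have : y - ‖y‖⁻¹ • y = (1 - ‖y‖⁻¹) • y := by rw [sub_smul, one_smul]
      rw [this, norm_smul, Real.norm_of_nonneg (by
        rw [sub_nonneg]; exact inv_le_one_of_one_le₀ hy.le), sub_mul, one_mul, inv_mul_cancel₀ hy0]
    have h3 : ‖y‖ - 1 ≤ ‖x - y‖ := by
      have := norm_sub_norm_le y x
      rw [norm_sub_rev] at this
      linarith
    have h4 : ‖x - ‖y‖⁻¹ • y‖ ≤ 2 * ‖x - y‖ := by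
      calc ‖x - ‖y‖⁻¹ • y‖ = ‖(x - y) + (y - ‖y‖⁻¹ • y)‖ := by congr 1; abel
        _ ≤ ‖x - y‖ + ‖y - ‖y‖⁻¹ • y‖ := norm_add_le _ _
        _ ≤ 2 * ‖x - y‖ := by rw [h2]; linarith
    calc ‖h x‖ ≤ c * ‖x - ‖y‖⁻¹ • y‖ := h1
      _ ≤ c * (2 * ‖x - y‖) := by gcongr
      _ = _ := by ring
  refine LipschitzWith.of_dist_le_mul fun x y => ?_
  rw [dist_eq_norm, dist_eq_norm]
  push_cast
  by_cases hx : ‖x‖ ≤ 1 <;> by_cases hy : ‖y‖ ≤ 1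
  · rw [indicator_of_mem (by simpa using hx), indicator_of_mem (by simpa using hy)]
    have := hl.norm_sub_le (x := x) (y := y) (by simpa using hx) (by simpa using hy)
    have h' : 0 ≤ c * ‖x - y‖ := by positivity
    linarith
  · rw [indicator_of_mem (by simpa using hx), indicator_of_notMem (by simpa using hy), sub_zero]
    exact key x y hx (not_le.mp hy)
  · rw [indicator_of_notMem (by simpa using hx), indicator_of_mem (by simpa using hy), zero_sub,
      norm_neg, norm_sub_rev]
    exact key y x hy (not_le.mp hx)
  · rw [indicator_of_notMem (by simpa using hx), indicator_of_notMem (by simpa using hy)]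
    simp
    positivity

/-- A small Lipschitz perturbation of the identity is bijective. -/
theorem bijective_id_add_of_lipschitzWith {E : Type*} [NormedAddCommGroup E] [NormedSpace ℝ E]
    [CompleteSpace E] {g : E → E} {c : NNReal} (hg : LipschitzWith c g) (hc : c < 1) :
    Function.Bijective fun x => x + g x := by
  have ha : ApproximatesLinearOn (fun x => x + g x)
      ((ContinuousLinearEquiv.refl ℝ E : E ≃L[ℝ] E) : E →L[ℝ] E) univ c := by
    intro x _ y _
    simpa [add_sub_add_comm] using hg.norm_sub_le x y
  have hc' : Subsingleton E ∨
      c < ‖((ContinuousLinearEquiv.refl ℝ E).symm : E →L[ℝ] E)‖₊⁻¹ := by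
    rcases subsingleton_or_nontrivial E with h | h
    · exact Or.inl h
    · right
      simpa using hc
  refine ⟨fun x y hxy => ?_, ha.surjective hc'⟩
  have := ha.injOn hc' (mem_univ x) (mem_univ y) hxy
  exact this

/-- If `h` is continuously differentiable on the closed unit ball and vanishes on its boundary,
then the integral of `det (1 + h')` over the ball is the volume of the ball. -/
theorem setIntegral_det_one_add_fderiv {E : Type*} [NormedAddCommGroup E] [NormedSpace ℝ E]
    [FiniteDimensional ℝ E] [MeasurableSpace E] [BorelSpace E] (μ : Measure E)
    [μ.IsAddHaarMeasure] {h : E → E}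
    (hd : ∀ x ∈ closedBall (0 : E) 1, ContDiffAt ℝ 1 h x) (h0 : ∀ x, ‖x‖ = 1 → h x = 0) :
    ∫ x in ball (0 : E) 1, (1 + fderiv ℝ h x).det ∂μ = μ.real (ball 0 1) := by
  have hcpt : IsCompact (closedBall (0 : E) 1) := isCompact_closedBall 0 1
  have hcont : ContinuousOn (fderiv ℝ h) (closedBall 0 1) := fun x hx =>
    ((hd x hx).continuousAt_fderiv one_ne_zero).continuousWithinAt
  obtain ⟨c, hc⟩ : ∃ c, LipschitzOnWith c h (closedBall 0 1) := by
    refine LocallyLipschitzOn.exists_lipschitzOnWith_of_compact hcpt fun x hx => ?_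
    obtain ⟨K, t, ht, hK⟩ := (hd x hx).exists_lipschitzOnWith
    exact ⟨K, t, mem_nhdsWithin_of_mem_nhds ht, hK⟩
  have hG := lipschitzWith_indicator_closedBall hc h0
  set G := (closedBall (0 : E) 1).indicator h with hGdef
  -- The determinant is 1 at `t = 0`; compactness makes its positivity uniform in `x`.
  have hpos : ∀ᶠ t : ℝ in 𝓝 0, ∀ x ∈ closedBall (0 : E) 1, 0 < (1 + t • fderiv ℝ h x).det := by
    refine hcpt.eventually_forall_of_forall_eventually fun x hx => ?_
    have hca : ContinuousAt (fun z : ℝ × E => (1 + z.1 • fderiv ℝ h z.2).det) (0, x) := by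
      refine ContinuousLinearMap.continuous_det.continuousAt.comp ?_
      refine continuousAt_const.add (continuousAt_fst.smul ?_)
      exact ContinuousAt.comp (f := Prod.snd) ((hd x hx).continuousAt_fderiv one_ne_zero)
        continuousAt_snd
    refine hca.eventually (lt_mem_nhds ?_)
    simp [ContinuousLinearMap.det]
  obtain ⟨ε₁, hε₁, hpos⟩ := Metric.eventually_nhds_iff.mp hpos
  -- Below `ε` the determinants are positive and `t • G` is a contraction. The summand 1 in `2 * c +
  -- 1` covers `c = 0`.
  obtain ⟨ε, hε, hεle, hεc⟩ : ∃ ε : ℝ, 0 < ε ∧ ε ≤ ε₁ ∧ ε * (2 * c) < 1 := by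
    refine ⟨min ε₁ (1 / (2 * c + 1)), by positivity, min_le_left _ _, ?_⟩
    have h2 : (0 : ℝ) < 2 * c + 1 := by positivity
    calc min ε₁ (1 / (2 * c + 1)) * (2 * c) ≤ 1 / (2 * c + 1) * (2 * c : ℝ) := by
          gcongr; exact min_le_right _ _
      _ < 1 := by rw [one_div_mul_eq_div, div_lt_one h2]; linarith
  have hsmall : ∀ t : ℝ, 0 < t → t < ε →
      ∫ x in ball (0 : E) 1, (1 + t • fderiv ℝ h x).det ∂μ = μ.real (ball 0 1) := by
    intro t ht0 htε
    have hbij : Function.Bijective fun x => x + t • G x := by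
      have hl : LipschitzWith (t.toNNReal * (2 * c)) fun x => t • G x := by
        refine LipschitzWith.of_dist_le_mul fun x y => ?_
        have := hG.dist_le_mul x y
        rw [dist_smul₀, Real.norm_of_nonneg ht0.le]
        push_cast [Real.coe_toNNReal t ht0.le] at this ⊢
        rw [mul_assoc t]
        gcongr
      refine bijective_id_add_of_lipschitzWith hl ?_
      rw [← NNReal.coe_lt_coe]
      push_cast [Real.coe_toNNReal t ht0.le]
      refine lt_of_le_of_lt ?_ hεc
      gcongr
    have hout : ∀ x, x ∉ ball (0 : E) 1 → x + t • G x = x := by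
      intro x hx
      have hx1 : 1 ≤ ‖x‖ := by simpa using hx
      have : G x = 0 := by
        rcases hx1.eq_or_lt with h1 | h1
        · rw [hGdef, indicator_of_mem (by simp [h1.symm.le])]
          exact h0 x h1.symm
        · exact indicator_of_notMem (by simpa using h1) _
      simp [this]
    -- A bijection of the space that fixes every point outside the ball maps the ball onto itself.
    have himg : (fun x => x + t • G x) '' ball (0 : E) 1 = ball 0 1 := by
      have : (fun x => x + t • G x) '' (ball (0 : E) 1)ᶜ = (ball 0 1)ᶜ := by
        exact (image_congr fun x hx => hout x hx).trans (image_id _)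
      rw [← compl_inj_iff, ← image_compl_eq hbij, this]
    have hderiv : ∀ x ∈ ball (0 : E) 1,
        HasFDerivWithinAt (fun x => x + t • G x) (1 + t • fderiv ℝ h x) (ball 0 1) x := by
      intro x hx
      have h1 : HasFDerivAt h (fderiv ℝ h x) x :=
        ((hd x (ball_subset_closedBall hx)).differentiableAt one_ne_zero).hasFDerivAt
      have h2 : G =ᶠ[𝓝 x] h := by
        filter_upwards [isOpen_ball.mem_nhds hx] with y hy
        exact indicator_of_mem (ball_subset_closedBall hy) _
      exact ((hasFDerivAt_id x).add ((h1.congr_of_eventuallyEq h2).const_smul t)).hasFDerivWithinAt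
    have := integral_image_eq_integral_abs_det_fderiv_smul μ measurableSet_ball hderiv
      hbij.injective.injOn (fun _ => (1 : ℝ))
    rw [himg] at this
    simp only [smul_eq_mul, mul_one, integral_const, measureReal_restrict_apply_univ] at this
    rw [this]
    refine setIntegral_congr_fun measurableSet_ball fun x hx => ?_
    refine (abs_of_pos (hpos ?_ x (ball_subset_closedBall hx))).symm
    rw [dist_zero_right, Real.norm_of_nonneg ht0.le]
    exact htε.trans_le hεle
  -- Nodes and weights do not depend on `x`, so the value at `t = 1` is recovered under the integral
  -- from small values of `t`.
  obtain ⟨v, w, hv, hw, hint⟩ := exists_interpolation_weights (Module.finrank ℝ E) hε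
  have hpt : ∀ x, (1 + fderiv ℝ h x).det = ∑ j ∈ Finset.range (Module.finrank ℝ E + 1),
      w j * (1 + v j • fderiv ℝ h x).det := by
    intro x
    obtain ⟨p, hp, hpe⟩ := exists_polynomial_eval_eq_det_one_add_smul (fderiv ℝ h x)
    have := hint p hp
    simpa only [hpe, one_smul] using this
  have hI : ∀ t : ℝ, IntegrableOn (fun x => (1 + t • fderiv ℝ h x).det) (ball 0 1) μ := by
    intro t
    refine IntegrableOn.mono_set ?_ ball_subset_closedBall
    refine ContinuousOn.integrableOn_compact hcpt ?_
    exact ContinuousLinearMap.continuous_det.comp_continuousOn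
      (continuousOn_const.add (hcont.const_smul t))
  simp_rw [hpt]
  rw [integral_finsetSum _ fun j _ => (hI (v j)).const_mul (w j)]
  simp_rw [integral_const_mul]
  rw [Finset.sum_congr rfl fun j _ => by rw [hsmall (v j) (hv j).1 (hv j).2], ← Finset.sum_mul, hw,
    one_mul]

variable {E : Type*} [NormedAddCommGroup E] [InnerProductSpace ℝ E] [FiniteDimensional ℝ E]

/-- There is no continuously differentiable retraction of the unit ball onto the unit sphere. -/
theorem not_exists_contDiff_retraction {h : E → E}
    (hd : ∀ x ∈ closedBall (0 : E) 1, ContDiffAt ℝ 1 h x) (h0 : ∀ x, ‖x‖ = 1 → h x = 0)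
    (h1 : ∀ x ∈ closedBall (0 : E) 1, ‖x + h x‖ = 1) : False := by
  borelize E
  have hI := setIntegral_det_one_add_fderiv (Measure.addHaar : Measure E) hd h0
  have hz : ∀ x ∈ ball (0 : E) 1, (1 + fderiv ℝ h x).det = 0 := by
    intro x hx
    have hdx : HasFDerivAt (fun y => y + h y) (1 + fderiv ℝ h x) x :=
      (hasFDerivAt_id x).add
        ((hd x (ball_subset_closedBall hx)).differentiableAt one_ne_zero).hasFDerivAt
    -- Differentiating `‖x + h x‖ ^ 2 = 1` puts the range of the derivative into the complement of
    -- the nonzero vector `x + h x`, so the derivative is not onto.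
    have horth : ∀ v, inner ℝ (x + h x) ((1 + fderiv ℝ h x) v) = 0 := by
      intro v
      have hd2 := (hdx.norm_sq).unique ((hasFDerivAt_const (1 : ℝ) x).congr_of_eventuallyEq (by
        filter_upwards [isOpen_ball.mem_nhds hx] with y hy
        simp [h1 y (ball_subset_closedBall hy)]))
      have := congrArg (fun L => L v) hd2
      have h2 : (2 : ℝ) * inner ℝ (x + h x) ((1 + fderiv ℝ h x) v) = 0 := by
        simpa only [smul_apply, zero_apply, ContinuousLinearMap.comp_apply, innerSL_apply_apply,
          smul_eq_mul, nsmul_eq_mul, Nat.cast_ofNat] using this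
      linarith
    by_contra hne
    obtain ⟨v, hv⟩ : ∃ v, (1 + fderiv ℝ h x) v = x + h x := by
      have hu : IsUnit (LinearMap.det ((1 + fderiv ℝ h x : E →L[ℝ] E) : E →ₗ[ℝ] E)) :=
        isUnit_iff_ne_zero.mpr hne
      exact (LinearEquiv.ofIsUnitDet (f := ((1 + fderiv ℝ h x : E →L[ℝ] E) : E →ₗ[ℝ] E))
        (v := Module.finBasis ℝ E) (v' := Module.finBasis ℝ E)
        (by rw [LinearMap.det_toMatrix]; exact hu)).surjective (x + h x)
    have := horth v
    rw [hv, real_inner_self_eq_norm_sq, h1 x (ball_subset_closedBall hx)] at this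
    norm_num at this
  rw [setIntegral_congr_fun measurableSet_ball hz, integral_zero] at hI
  have : 0 < (Measure.addHaar : Measure E).real (ball 0 1) :=
    ENNReal.toReal_pos (measure_ball_pos _ _ one_pos).ne' measure_ball_lt_top.ne
  exact this.ne hI

/-- Brouwer's theorem for smooth maps into the open unit ball. -/
theorem exists_fixedPoint_of_contDiff {g : E → E} (hg : ContDiff ℝ 1 g) (hb : ∀ x, ‖g x‖ < 1) :
    ∃ x ∈ closedBall (0 : E) 1, g x = x := by
  by_contra! hne
  -- The ray from `g x` through `x` leaves the ball at `x + s • (x - g x)`, where `s` is the larger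
  -- root of `a s² + 2 b s = 1 - ‖x‖²` and `D` is the reduced discriminant. On the sphere `b > 0`,
  -- so `s = 0`; and `D > 0` on the closed ball keeps the root smooth.
  let a : E → ℝ := fun x => ‖x - g x‖ ^ 2
  let b : E → ℝ := fun x => inner ℝ x (x - g x)
  let D : E → ℝ := fun x => b x ^ 2 + a x * (1 - ‖x‖ ^ 2)
  have ha : ∀ x ∈ closedBall (0 : E) 1, 0 < a x := fun x hx => by
    have : x - g x ≠ 0 := sub_ne_zero.mpr (hne x hx).symm
    positivity
  have hbpos : ∀ x, ‖x‖ = 1 → 0 < b x := by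
    intro x hx
    have h1 : inner ℝ x (g x) ≤ ‖x‖ * ‖g x‖ := real_inner_le_norm x (g x)
    simp only [b, inner_sub_right, real_inner_self_eq_norm_sq]
    rw [hx] at h1 ⊢
    linarith [hb x]
  have hD : ∀ x ∈ closedBall (0 : E) 1, 0 < D x := by
    intro x hx
    have hx1 : ‖x‖ ≤ 1 := by simpa using hx
    rcases hx1.eq_or_lt with h1 | h1
    · have := hbpos x h1
      simp only [D, h1]
      norm_num
      positivity
    · have h2 : 0 < 1 - ‖x‖ ^ 2 := by nlinarith [norm_nonneg x]
      have := mul_pos (ha x hx) h2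
      simp only [D]
      positivity
  have hca : ContDiff ℝ 1 a := (contDiff_id.sub hg).norm_sq ℝ
  have hcb : ContDiff ℝ 1 b := contDiff_id.inner ℝ (contDiff_id.sub hg)
  have hcD : ContDiff ℝ 1 D :=
    (hcb.pow 2).add (hca.mul (contDiff_const.sub (contDiff_id.norm_sq ℝ)))
  let s : E → ℝ := fun x => (√(D x) - b x) / a x
  refine not_exists_contDiff_retraction (h := fun x => s x • (x - g x)) (fun x hx => ?_)
    (fun x hx => ?_) fun x hx => ?_
  · refine ContDiffAt.smul ?_ (contDiff_id.sub hg).contDiffAt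
    exact ((hcD.contDiffAt.sqrt (hD x hx).ne').sub hcb.contDiffAt).div hca.contDiffAt (ha x hx).ne'
  · have : s x = 0 := by
      simp [s, D, hx, Real.sqrt_sq (hbpos x hx).le]
    simp [this]
  · have hsq : ‖x + s x • (x - g x)‖ ^ 2 = 1 := by
      rw [norm_add_sq_real, inner_smul_right, norm_smul, mul_pow, Real.norm_eq_abs, sq_abs]
      change ‖x‖ ^ 2 + 2 * (s x * b x) + s x ^ 2 * a x = 1
      have h1 : s x * a x = √(D x) - b x := div_mul_cancel₀ _ (ha x hx).ne'
      have h2 : √(D x) ^ 2 = b x ^ 2 + a x * (1 - ‖x‖ ^ 2) := Real.sq_sqrt (hD x hx).le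
      have h3 : (s x * a x + b x) ^ 2 = b x ^ 2 + a x * (1 - ‖x‖ ^ 2) := by
        rw [h1, sub_add_cancel, h2]
      refine mul_left_cancel₀ (ha x hx).ne' ?_
      linear_combination h3
    exact (sq_eq_sq₀ (norm_nonneg _) zero_le_one).mp (by rw [hsq, one_pow])

/-- Brouwer's fixed point theorem for continuous maps with values in the ball of radius `1 / 2`. -/
theorem exists_fixedPoint_of_norm_le_half {f : E → E} (hf : Continuous f)
    (hb : ∀ x, ‖f x‖ ≤ 1 / 2) : ∃ x, f x = x := by
  by_contra! hne
  obtain ⟨x₀, -, hmin⟩ := (isCompact_closedBall (0 : E) 1).exists_isMinOn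
    ⟨0, by simp⟩ (f := fun x => ‖f x - x‖) (by fun_prop)
  have hm : 0 < ‖f x₀ - x₀‖ := norm_pos_iff.mpr (sub_ne_zero.mpr (hne x₀))
  -- A fixed point of `g` would be moved by `f` less than the minimal displacement; the bound `1 /
  -- 2` keeps `g` inside the open ball.
  obtain ⟨g, hg, hgf, -⟩ := hf.exists_contDiff_approx 1
    (ε := fun _ => min ‖f x₀ - x₀‖ (1 / 2)) continuous_const (fun _ => by positivity)
  obtain ⟨x, hx, hfix⟩ := exists_fixedPoint_of_contDiff (g := g) hg fun x => by
    have h1 := (hgf x).trans_le (min_le_right _ _)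
    rw [dist_eq_norm] at h1
    calc ‖g x‖ = ‖(g x - f x) + f x‖ := by rw [sub_add_cancel]
      _ ≤ ‖g x - f x‖ + ‖f x‖ := norm_add_le _ _
      _ < 1 := by linarith [hb x]
  have h1 := (hgf x).trans_le (min_le_left _ _)
  have h2 := isMinOn_iff.mp hmin x hx
  rw [dist_comm, dist_eq_norm, hfix] at h1
  exact absurd h1 (not_lt.mpr h2)

/-- Brouwer's fixed point theorem for bounded continuous maps of a Euclidean space. -/
theorem exists_fixedPoint_of_bounded {f : E → E} (hf : Continuous f) {R : ℝ}
    (hb : ∀ x, ‖f x‖ ≤ R) : ∃ x, f x = x := by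
  have hR : 0 ≤ R := (norm_nonneg _).trans (hb 0)
  have hc : 0 < 2 * (R + 1) := by positivity
  obtain ⟨x, hx⟩ := exists_fixedPoint_of_norm_le_half
    (f := fun x => (2 * (R + 1))⁻¹ • f ((2 * (R + 1)) • x)) (by fun_prop) fun x => by
      rw [norm_smul, norm_inv, Real.norm_of_nonneg hc.le, inv_mul_le_iff₀ hc]
      linarith [hb ((2 * (R + 1)) • x)]
  refine ⟨(2 * (R + 1)) • x, ?_⟩
  conv_rhs => rw [← hx]
  rw [smul_inv_smul₀ hc.ne']

end Brouwer

/-! ### M-matrices and quasilinear systems -/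

section MMatrix

variable {ι : Type*} [Fintype ι]

/-- A matrix with nonpositive off-diagonal entries and positive column sums is monotone. -/
theorem nonneg_of_mulVec_nonneg {B : Matrix ι ι ℝ} (hoff : ∀ p q, p ≠ q → B p q ≤ 0)
    (hcol : ∀ q, 0 < ∑ p, B p q) {x : ι → ℝ} (hx : 0 ≤ B *ᵥ x) : 0 ≤ x := by
  classical
  by_contra hneg
  obtain ⟨q₀, hq₀⟩ : ∃ q, x q < 0 := by
    by_contra! h
    exact hneg h
  -- Add the rows in `N`. Columns in `N` keep a positive sum, since only nonpositive entries are
  -- dropped; the other columns have nonpositive sums. So the total would be negative.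
  let N := Finset.univ.filter fun q => x q < 0
  have hsum : 0 ≤ ∑ p ∈ N, (B *ᵥ x) p := Finset.sum_nonneg fun p _ => hx p
  have hswap : ∑ p ∈ N, (B *ᵥ x) p = ∑ q, (∑ p ∈ N, B p q) * x q := by
    simp only [Matrix.mulVec, dotProduct, Finset.sum_mul]
    exact Finset.sum_comm
  have hin : ∀ q ∈ N, 0 < ∑ p ∈ N, B p q := by
    intro q hq
    have h1 : ∑ p ∈ Nᶜ, B p q ≤ 0 := Finset.sum_nonpos fun p hp => hoff p q <| by
      rintro rfl
      exact Finset.mem_compl.mp hp hq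
    have h2 := Finset.sum_add_sum_compl N fun p => B p q
    linarith [hcol q]
  have hterm : ∀ q, (∑ p ∈ N, B p q) * x q ≤ 0 := by
    intro q
    by_cases hq : q ∈ N
    · exact mul_nonpos_of_nonneg_of_nonpos (hin q hq).le (Finset.mem_filter.mp hq).2.le
    · refine mul_nonpos_of_nonpos_of_nonneg (Finset.sum_nonpos fun p hp => hoff p q ?_) ?_
      · rintro rfl
        exact hq hp
      · simpa [N] using hq
  have hlt : ∑ q, (∑ p ∈ N, B p q) * x q < 0 := by
    refine Finset.sum_neg' (fun q _ => hterm q) ⟨q₀, Finset.mem_univ _, ?_⟩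
    exact mul_neg_of_pos_of_neg (hin q₀ (by simp [N, hq₀])) hq₀
  linarith

/-- By monotonicity a kernel vector and its negative are both nonnegative. -/
theorem isUnit_det_of_sum_col_pos [DecidableEq ι] {B : Matrix ι ι ℝ}
    (hoff : ∀ p q, p ≠ q → B p q ≤ 0) (hcol : ∀ q, 0 < ∑ p, B p q) : IsUnit B.det := by
  rw [isUnit_iff_ne_zero]
  intro h0
  obtain ⟨v, hv, hBv⟩ := Matrix.exists_mulVec_eq_zero_iff.mpr h0
  refine hv (le_antisymm ?_ (nonneg_of_mulVec_nonneg hoff hcol hBv.ge))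
  have : 0 ≤ -v := nonneg_of_mulVec_nonneg hoff hcol (by rw [Matrix.mulVec_neg, hBv, neg_zero])
  exact neg_nonneg.mp this

/-- A quasilinear system whose matrices have nonpositive off-diagonal entries and column sums that
are uniformly positive has a nonnegative solution for every nonnegative right-hand side. -/
theorem exists_nonneg_mulVec_eq {B : (ι → ℝ) → Matrix ι ι ℝ}
    (hB : Continuous fun U => B (U ⊔ 0)) (hoff : ∀ U, 0 ≤ U → ∀ p q, p ≠ q → B U p q ≤ 0)
    {s : ι → ℝ} (hs : ∀ q, 0 < s q) (hcol : ∀ U, 0 ≤ U → ∀ q, s q ≤ ∑ p, B U p q)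
    {b : ι → ℝ} (hb : 0 ≤ b) : ∃ U, 0 ≤ U ∧ B U *ᵥ U = b := by
  classical
  have hcol' : ∀ U, 0 ≤ U → ∀ q, 0 < ∑ p, B U p q := fun U hU q => (hs q).trans_le (hcol U hU q)
  have hdet : ∀ U, IsUnit (B (U ⊔ 0)).det := fun U =>
    isUnit_det_of_sum_col_pos (hoff _ le_sup_right) (hcol' _ le_sup_right)
  -- Truncation defines `Φ` on the whole space, as Brouwer's theorem for bounded maps requires.
  let Φ : (ι → ℝ) → ι → ℝ := fun U => (B (U ⊔ 0))⁻¹ *ᵥ b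
  have hΦ : ∀ U, B (U ⊔ 0) *ᵥ Φ U = b := fun U => by
    rw [Matrix.mulVec_mulVec, Matrix.mul_nonsing_inv _ (hdet U), Matrix.one_mulVec]
  have hΦ0 : ∀ U, 0 ≤ Φ U := fun U =>
    nonneg_of_mulVec_nonneg (hoff _ le_sup_right) (hcol' _ le_sup_right) (by rw [hΦ]; exact hb)
  -- The sum of all equations has nonnegative terms on the left, so each one is at most the sum of
  -- `b`.
  have hΦle : ∀ U q, Φ U q ≤ (∑ p, b p) / s q := by
    intro U q
    have h1 : ∑ p, b p = ∑ q, (∑ p, B (U ⊔ 0) p q) * Φ U q := by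
      conv_lhs => rw [← hΦ U]
      simp only [Matrix.mulVec, dotProduct, Finset.sum_mul]
      exact Finset.sum_comm
    rw [le_div_iff₀ (hs q), h1, mul_comm]
    calc s q * Φ U q ≤ (∑ p, B (U ⊔ 0) p q) * Φ U q :=
          mul_le_mul_of_nonneg_right (hcol _ le_sup_right q) (hΦ0 U q)
      _ ≤ _ := Finset.single_le_sum (f := fun q => (∑ p, B (U ⊔ 0) p q) * Φ U q)
          (fun q _ => mul_nonneg (hcol' _ le_sup_right q).le (hΦ0 U q)) (Finset.mem_univ q)
  have hΦc : Continuous Φ := by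
    refine Continuous.matrix_mulVec ?_ continuous_const
    simp only [Matrix.inv_def, Ring.inverse_eq_inv']
    exact (hB.matrix_det.inv₀ fun U => (hdet U).ne_zero).smul hB.matrix_adjugate
  obtain ⟨R, hR⟩ := ((isCompact_Icc (a := (0 : ι → ℝ)) (b := fun q => (∑ p, b p) / s q)).image
    (PiLp.continuous_toLp 2 fun _ : ι => ℝ)).isBounded.exists_norm_le
  obtain ⟨x, hx⟩ := exists_fixedPoint_of_bounded
    (f := fun x : EuclideanSpace ℝ ι => WithLp.toLp 2 (Φ x.ofLp))
    ((PiLp.continuous_toLp 2 _).comp (hΦc.comp (PiLp.continuous_ofLp 2 _)))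
    fun x => hR _ ⟨_, ⟨hΦ0 _, hΦle _⟩, rfl⟩
  have hfix : Φ x.ofLp = x.ofLp := congrArg WithLp.ofLp hx
  have hx0 : 0 ≤ x.ofLp := hfix ▸ hΦ0 x.ofLp
  refine ⟨x.ofLp, hx0, ?_⟩
  have := hΦ x.ofLp
  rwa [hfix, sup_of_le_left hx0] at this

end MMatrix

/-! ### Geometry of the mesh and signs of the coefficients -/

theorem centroid_mem_interior_triangle {a b c : Plane} (h : cross (b - a) (c - b) ≠ 0) :
    (1 / 3 : ℝ) • (a + b + c) ∈ interior (convexHull ℝ {a, b, c}) := by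
  have hli : LinearIndependent ℝ ![b - a, c - a] := by
    rw [LinearIndependent.pair_iff]
    intro s t hst
    have h0 := congrArg (fun v : Plane => v 0) hst
    have h1 := congrArg (fun v : Plane => v 1) hst
    simp [cross] at h h0 h1
    have hne : (b 0 - a 0) * (c 1 - b 1) - (b 1 - a 1) * (c 0 - b 0) ≠ 0 := h
    constructor
    · refine (mul_eq_zero.mp ?_).resolve_right hne
      linear_combination (c 1 - a 1) * h0 - (c 0 - a 0) * h1
    · refine (mul_eq_zero.mp ?_).resolve_right hne
      linear_combination (b 0 - a 0) * h1 - (b 1 - a 1) * h0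
  have hai : AffineIndependent ℝ ![a, b, c] := by
    rw [affineIndependent_iff_linearIndependent_vsub ℝ _ (0 : Fin 3)]
    refine (linearIndependent_equiv' (finSuccAboveEquiv (0 : Fin 3)) ?_).mp hli
    ext i : 1
    fin_cases i <;> rfl
  have htop : affineSpan ℝ (Set.range ![a, b, c]) = ⊤ := by
    rw [hai.affineSpan_eq_top_iff_card_eq_finrank_add_one]
    simp
  let bs : AffineBasis (Fin 3) ℝ Plane := ⟨![a, b, c], hai, htop⟩
  have hmem := bs.centroid_mem_interior_convexHull
  have hr : Set.range bs = {a, b, c} := by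
    change Set.range ![a, b, c] = _
    simp only [Matrix.range_cons, Matrix.range_empty, Set.union_empty, Set.singleton_union]
  rw [hr] at hmem
  convert hmem using 1
  rw [Finset.centroid_def, Finset.affineCombination_eq_linear_combination _ _ _
    (by simp [Finset.centroidWeights])]
  simp only [Finset.centroidWeights, Fin.sum_univ_three, Finset.card_univ, Fintype.card_fin,
    Function.const]
  change _ = ((3 : ℕ) : ℝ)⁻¹ • a + ((3 : ℕ) : ℝ)⁻¹ • b + ((3 : ℕ) : ℝ)⁻¹ • c
  simp [smul_add]

namespace QuadMesh

variable {Ω : Set Plane} {Node Cell : Type*} (T : QuadMesh Ω Node Cell)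

theorem cross_pos (K : Cell) (i : Fin 4) :
    0 < cross (T.pt K (i + 1) - T.pt K i) (T.pt K (i + 2) - T.pt K (i + 1)) :=
  T.strictly_convex K i

/-- The Jacobian at the centre is the area of `K`: half the sum of the cross products at the
vertices 1 and 3. -/
theorem jacQ_pos (K : Cell) : 0 < T.jacQ K := by
  have h1 := T.cross_pos K 0
  have h2 := T.cross_pos K 2
  simp only [zero_add, show (2 + 1 : Fin 4) = 3 from rfl, show (2 + 2 : Fin 4) = 0 from rfl,
    cross, PiLp.sub_apply] at h1 h2
  simp only [jacQ, jacobi, Matrix.det_fin_two_of, PiLp.sub_apply, PiLp.add_apply]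
  linarith

theorem cell_subset_closure (K : Cell) : T.cell K ⊆ closure Ω := by
  rw [← T.cover]
  exact Set.subset_iUnion (fun K => convexHull ℝ (Set.range fun i => T.pos (T.vert K i))) K

theorem pt_mem_cell (K : Cell) (i : Fin 4) : T.pt K i ∈ T.cell K :=
  subset_convexHull ℝ _ ⟨i, rfl⟩

theorem barycenter_mem_interior_cell (K : Cell) : T.barycenter K ∈ interior (T.cell K) := by
  have hc := centroid_mem_interior_triangle (T.cross_pos K 0).ne'
  have hsub : convexHull ℝ {T.pt K 0, T.pt K (0 + 1), T.pt K (0 + 2)} ⊆ T.cell K := by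
    refine convexHull_mono ?_
    rintro x (rfl | rfl | rfl) <;> exact ⟨_, rfl⟩
  -- The barycenter is 3/4 of the centroid of a corner triangle plus 1/4 of the fourth vertex.
  have := (convex_convexHull ℝ (Set.range (T.pt K))).combo_interior_self_mem_interior
    (interior_mono hsub hc) (T.pt_mem_cell K 3) (a := 3 / 4) (b := 1 / 4) (by norm_num)
    (by norm_num) (by norm_num)
  suffices heq : T.barycenter K = (3 / 4 : ℝ) • (1 / 3 : ℝ) •
      (T.pt K 0 + T.pt K (0 + 1) + T.pt K (0 + 2)) + (1 / 4 : ℝ) • T.pt K 3 by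
    rw [heq]
    exact this
  rw [barycenter, Fin.sum_univ_four, zero_add, zero_add]
  module

/-- An open convex set is the interior of its closure. The point must lie in `Ω` itself because `κ`
is positive definite only there. -/
theorem barycenter_mem (hΩ : IsConvexPolygonalDomain Ω) (K : Cell) : T.barycenter K ∈ Ω := by
  have h := interior_mono (T.cell_subset_closure K) (T.barycenter_mem_interior_cell K)
  rwa [hΩ.convex.interior_closure_eq_interior_of_nonempty_interior
    (by rw [hΩ.isOpen.interior_eq]; exact hΩ.nonempty), hΩ.isOpen.interior_eq] at h

theorem corner_triangle_subset_cell (K : Cell) (i : Fin 4) :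
    T.corner_triangle K i ⊆ T.cell K := by
  refine convexHull_mono ?_
  rintro x (rfl | rfl | rfl) <;> exact ⟨_, rfl⟩

theorem dualArea_pos (hΩ : IsConvexPolygonalDomain Ω) (P : Node) : 0 < T.dualArea P := by
  obtain ⟨K, i, rfl⟩ := T.node_mem P
  have hne : (interior (T.dualCell (T.vert K i))).Nonempty := by
    refine Set.Nonempty.mono (interior_mono (s := T.corner_triangle K i) fun x hx => ?_)
      ⟨(1 / 3 : ℝ) • (T.pt K (i + 3) + T.pt K i + T.pt K (i + 1)), ?_⟩
    · simp only [dualCell, Set.mem_iUnion]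
      exact ⟨K, i, rfl, hx⟩
    · have h := T.cross_pos K (i + 3)
      rw [show i + 3 + 1 = i by omega, show i + 3 + 2 = i + 1 by omega] at h
      exact centroid_mem_interior_triangle h.ne'
  have hsub : T.dualCell (T.vert K i) ⊆ closure Ω := by
    simp only [dualCell, Set.iUnion_subset_iff]
    exact fun K' j _ => (T.corner_triangle_subset_cell K' j).trans (T.cell_subset_closure K')
  exact ENNReal.toReal_pos (MeasureTheory.Measure.measure_pos_of_nonempty_interior _ hne).ne'
    (hΩ.isBounded.closure.subset hsub).measure_lt_top.ne

/-- Keeps the denominators positive where `U` vanishes. Finiteness of `Cell` bounds the family, so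
that `⨆` is a true supremum. -/
theorem meshSize_pos [Finite Cell] (K : Cell) : 0 < T.meshSize := by
  have hne : T.pt K 0 ≠ T.pt K 1 := by
    intro h
    have := T.cross_pos K 0
    rw [zero_add, h] at this
    simp [cross] at this
  have hb : Bornology.IsBounded (T.cell K) :=
    isBounded_convexHull.mpr (Set.finite_range _).isBounded
  calc 0 < dist (T.pt K 0) (T.pt K 1) := dist_pos.mpr hne
    _ ≤ Metric.diam (T.cell K) :=
      Metric.dist_le_diam_of_mem hb (T.pt_mem_cell K 0) (T.pt_mem_cell K 1)
    _ ≤ T.meshSize := le_ciSup (f := fun K => Metric.diam (T.cell K))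
      (Set.finite_range _).bddAbove K

theorem q_add_two (K : Cell) (i : Fin 4) : (T.q K (i + 2)).ofLp = -(T.q K i).ofLp := by
  rw [q, q, show i + 2 + 3 = i + 1 by omega, show i + 2 + 1 = i + 3 by omega]
  ext j
  fin_cases j <;> simp [rot]

theorem fluxMain_nonneg (hΩ : IsConvexPolygonalDomain Ω)
    {κ : Plane → Matrix (Fin 2) (Fin 2) ℝ} (hκ : ∀ x ∈ Ω, (κ x).PosDef) (K : Cell) (i : Fin 4) :
    0 ≤ T.fluxMain κ K i := by
  refine div_nonneg ?_ (by have := T.jacQ_pos K; positivity)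
  simpa using (hκ _ (T.barycenter_mem hΩ K)).posSemidef.transpose.dotProduct_mulVec_nonneg
    (T.q K i).ofLp

theorem fluxMain_add_two (κ : Plane → Matrix (Fin 2) (Fin 2) ℝ) (K : Cell) (i : Fin 4) :
    T.fluxMain κ K (i + 2) = T.fluxMain κ K i := by
  simp only [fluxMain, q_add_two, Matrix.mulVec_neg, dotProduct_neg, neg_dotProduct, neg_neg]

/-- Both normals change sign, which leaves their product unchanged, while the difference of the
nodal values is reversed. -/
theorem fluxResidual_add_two (κ : Plane → Matrix (Fin 2) (Fin 2) ℝ) (U : Node → ℝ) (K : Cell)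
    (i : Fin 4) : T.fluxResidual κ U K (i + 2) = -T.fluxResidual κ U K i := by
  simp only [fluxResidual]
  rw [show i + 2 + 1 = (i + 1) + 2 by omega, show i + 2 + 3 = i + 1 by omega,
    show i + 1 + 2 = i + 3 by omega, ← show i + 1 + 2 = i + 3 by omega, q_add_two, q_add_two]
  simp only [Matrix.mulVec_neg, dotProduct_neg, neg_dotProduct, neg_neg]
  ring

/-- Local conservation: the sign change of the residual turns its negative part into its positive
part. -/
theorem inCoeff_add_two (κ : Plane → Matrix (Fin 2) (Fin 2) ℝ) (M C : ℝ) (U : Node → ℝ)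
    (K : Cell) (i : Fin 4) : T.inCoeff κ M C U K (i + 2) = T.outCoeff κ M C U K i := by
  rw [inCoeff, outCoeff, fluxMain_add_two, fluxResidual_add_two, abs_neg, sub_neg_eq_add,
    show i + 2 + 2 = i by omega]

/-! ### The scheme matrix -/

section

variable [Fintype Cell]

theorem boundaryCoeff_nonneg {δ γ : Cell → Fin 4 → ℝ}
    (hδ : ∀ K i, T.IsBoundaryEdge K i → 0 ≤ δ K i)
    (hγ : ∀ K i, T.IsBoundaryEdge K i → 0 < γ K i) (P : Node) : 0 ≤ T.boundaryCoeff δ γ P := by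
  refine Finset.sum_nonneg fun K _ => Finset.sum_nonneg fun i _ => ?_
  split_ifs with h
  · exact mul_nonneg (div_nonneg (hδ K i h.1) (hγ K i h.1).le) dist_nonneg
  · exact le_rfl

theorem denominator_pos {M C : ℝ} (hM : 0 < M) (hC : 0 < C) {U : Node → ℝ} (hU : 0 ≤ U) (K : Cell)
    (P : Node) : 0 < M * U P + C * T.meshSize ^ 2 := by
  have h1 := T.meshSize_pos K
  have h2 : 0 ≤ U P := hU P
  positivity

theorem inCoeff_nonneg (hΩ : IsConvexPolygonalDomain Ω)
    {κ : Plane → Matrix (Fin 2) (Fin 2) ℝ} (hκ : ∀ x ∈ Ω, (κ x).PosDef) {M C : ℝ} (hM : 0 < M)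
    (hC : 0 < C) {U : Node → ℝ} (hU : 0 ≤ U) (K : Cell) (i : Fin 4) :
    0 ≤ T.inCoeff κ M C U K i := by
  refine add_nonneg (T.fluxMain_nonneg hΩ hκ K i)
    (div_nonneg (mul_nonneg ?_ hM.le) (T.denominator_pos hM hC hU K _).le)
  linarith [le_abs_self (T.fluxResidual κ U K i)]

variable [DecidableEq Node]

theorem schemeMatrix_nonpos (hΩ : IsConvexPolygonalDomain Ω)
    {κ : Plane → Matrix (Fin 2) (Fin 2) ℝ} (hκ : ∀ x ∈ Ω, (κ x).PosDef) (δ γ : Cell → Fin 4 → ℝ)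
    {M C : ℝ} (hM : 0 < M) (hC : 0 < C) {U : Node → ℝ} (hU : 0 ≤ U) {P Q : Node} (hPQ : P ≠ Q) :
    T.schemeMatrix κ δ γ M C U P Q ≤ 0 := by
  rw [schemeMatrix, Matrix.add_apply, Matrix.diagonal_apply_ne _ hPQ, add_zero]
  simp only [Matrix.sum_apply, Matrix.sub_apply]
  refine Finset.sum_nonpos fun K _ => Finset.sum_nonpos fun i _ => ?_
  rw [Matrix.single_apply_of_ne _ _ _ _ _ (by rintro ⟨h1, h2⟩; exact hPQ (h1.symm.trans h2)),
    zero_sub, neg_nonpos, Matrix.single_apply]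
  split_ifs
  · exact T.inCoeff_nonneg hΩ hκ hM hC hU K i
  · exact le_rfl

/-- Shifting `i` by 2 matches each incoming coefficient in the column with an outgoing one, so only
the boundary term survives. -/
theorem sum_schemeMatrix_col [Fintype Node] (κ : Plane → Matrix (Fin 2) (Fin 2) ℝ) (δ γ : Cell → Fin 4 → ℝ)
    (M C : ℝ) (U : Node → ℝ) (Q : Node) :
    ∑ P, T.schemeMatrix κ δ γ M C U P Q = T.boundaryCoeff δ γ Q := by
  have hsingle : ∀ (a b : Node) (c : ℝ), ∑ P, Matrix.single a b c P Q = if b = Q then c else 0 := by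
    intro a b c
    simp [Matrix.single_apply, ite_and]
  have hdiag : ∑ P, Matrix.diagonal (T.boundaryCoeff δ γ) P Q = T.boundaryCoeff δ γ Q := by
    simp [Matrix.diagonal_apply]
  simp only [schemeMatrix, Matrix.add_apply, Finset.sum_add_distrib, hdiag, Matrix.sum_apply,
    Matrix.sub_apply]
  rw [add_eq_right, Finset.sum_comm]
  refine Finset.sum_eq_zero fun K _ => ?_
  rw [Finset.sum_comm]
  simp only [Finset.sum_sub_distrib, hsingle]
  rw [sub_eq_zero, ← Equiv.sum_comp (Equiv.addRight (2 : Fin 4))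
    fun i => if T.vert K (i + 2) = Q then T.inCoeff κ M C U K i else 0]
  refine Finset.sum_congr rfl fun i _ => ?_
  rw [Equiv.coe_addRight, inCoeff_add_two, show i + 2 + 2 = i by omega]

theorem continuous_schemeMatrix_sup_zero (κ : Plane → Matrix (Fin 2) (Fin 2) ℝ)
    (δ γ : Cell → Fin 4 → ℝ) {M C : ℝ} (hM : 0 < M) (hC : 0 < C) :
    Continuous fun U => T.schemeMatrix κ δ γ M C (U ⊔ 0) := by
  have hU : ∀ P : Node, Continuous fun U : Node → ℝ => (U ⊔ 0) P := fun P =>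
    (continuous_apply P).sup continuous_const
  have hres : ∀ K i, Continuous fun U : Node → ℝ => T.fluxResidual κ (U ⊔ 0) K i := fun K i =>
    continuous_const.mul ((hU _).sub (hU _))
  have hden : ∀ (K : Cell) (P : Node) (U : Node → ℝ), M * (U ⊔ 0) P + C * T.meshSize ^ 2 ≠ 0 :=
    fun K P U => (T.denominator_pos hM hC le_sup_right K P).ne'
  have hout : ∀ K i, Continuous fun U : Node → ℝ => T.outCoeff κ M C (U ⊔ 0) K i := fun K i =>
    continuous_const.add (((((hres K i).abs.add (hres K i)).div_const 2).mul_const M).div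
      (((hU _).const_mul M).add continuous_const) (hden K _))
  have hin : ∀ K i, Continuous fun U : Node → ℝ => T.inCoeff κ M C (U ⊔ 0) K i := fun K i =>
    continuous_const.add (((((hres K i).abs.sub (hres K i)).div_const 2).mul_const M).div
      (((hU _).const_mul M).add continuous_const) (hden K _))
  have hsingle : ∀ (a b : Node) {c : (Node → ℝ) → ℝ}, Continuous c →
      Continuous fun U => Matrix.single a b (c U) := by
    intro a b c hc
    refine continuous_matrix fun i j => ?_
    simp only [Matrix.single_apply]
    split_ifs
    · exact hc
    · exact continuous_const
  refine Continuous.add ?_ continuous_const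
  refine continuous_finsetSum _ fun K _ => continuous_finsetSum _ fun i _ => ?_
  exact (hsingle _ _ (hout K i)).sub (hsingle _ _ (hin K i))

end

end QuadMesh

end MonotoneFVE

/-! ### Existence of a nonnegative solution -/

theorem theorem3p1 {Ω : Set MonotoneFVE.Plane} (hΩ : MonotoneFVE.IsConvexPolygonalDomain Ω)
    {Node Cell : Type*} [Fintype Node] [DecidableEq Node] [Fintype Cell]
    (T : MonotoneFVE.QuadMesh Ω Node Cell)
    (κ : MonotoneFVE.Plane → Matrix (Fin 2) (Fin 2) ℝ) (hκ : ∀ x ∈ Ω, (κ x).PosDef)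
    (δ γ : Cell → Fin 4 → ℝ)
    (hδ : ∀ K i, T.IsBoundaryEdge K i → 0 ≤ δ K i)
    (hγ : ∀ K i, T.IsBoundaryEdge K i → 0 < γ K i)
    (C : ℝ) (hC : 0 < C) (Δt : ℝ) (hΔt : 0 < Δt)
    (f g Uₙ : Node → ℝ) (hfg : 0 ≤ f + g) (hUₙ : 0 ≤ Uₙ)
    (M : ℝ) (hM : 0 < M) :
    ∃ U : Node → ℝ, 0 ≤ U ∧
      (T.areaMatrix + Δt • T.schemeMatrix κ δ γ M C U) *ᵥ U =
        Δt • (f + g) + T.areaMatrix *ᵥ Uₙ := by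
  have hcont : Continuous fun U =>
      T.areaMatrix + Δt • T.schemeMatrix κ δ γ M C (U ⊔ 0) :=
    continuous_const.add ((T.continuous_schemeMatrix_sup_zero κ δ γ hM hC).const_smul Δt)
  -- The dual areas serve as the lower bound of the column sums that is uniform in `U`.
  refine MonotoneFVE.exists_nonneg_mulVec_eq
    (B := fun U => T.areaMatrix + Δt • T.schemeMatrix κ δ γ M C U) hcont
    (fun U hU P Q hPQ => ?_) (T.dualArea_pos hΩ) (fun U _ Q => ?_) ?_
  · rw [Matrix.add_apply, Matrix.smul_apply, MonotoneFVE.QuadMesh.areaMatrix,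
      Matrix.diagonal_apply_ne _ hPQ, zero_add, smul_eq_mul]
    exact mul_nonpos_of_nonneg_of_nonpos hΔt.le (T.schemeMatrix_nonpos hΩ hκ δ γ hM hC hU hPQ)
  · simp only [Matrix.add_apply, Matrix.smul_apply, smul_eq_mul, Finset.sum_add_distrib,
      ← Finset.mul_sum, T.sum_schemeMatrix_col]
    have h1 : ∑ P, T.areaMatrix P Q = T.dualArea Q := by
      simp [MonotoneFVE.QuadMesh.areaMatrix, Matrix.diagonal_apply]
    rw [h1]
    exact le_add_of_nonneg_right (mul_nonneg hΔt.le (T.boundaryCoeff_nonneg hδ hγ Q))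
  · refine add_nonneg (smul_nonneg hΔt.le hfg) fun P => ?_
    rw [MonotoneFVE.QuadMesh.areaMatrix, Matrix.mulVec_diagonal]
    exact mul_nonneg (T.dualArea_pos hΩ P).le (hUₙ P)
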